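/- Let $V$ be a real vector space of dimension $N\ge 2$ (the tangent space at a point of a Lorentzian manifold) with a Lorentzian metric $g_{ab}$ of signature $(+,-,\dots,-)$ and a time orientation. For a $p$-form $\Omega$ ($1\le p\le N$) its superenergy tensor is $$T_{ab}\{\Omega\}=\frac{(-1)^{p-1}}{(p-1)!}\Big[\Omega_{aa_2\dots a_p}\Omega_b{}^{a_2\dots a_p}-\frac1{2p}(\Omega\cdot\Omega)\,g_{ab}\Big],\qquad \Omega\cdot\Omega=\Omega_{a_1\dots a_p}\Omega^{a_1\dots a_p}.$$ $\Omega$ is simple if $\Omega=\omega^1\wedge\dots\wedge\omega^p$ with linearly independent 1-forms $\omega^i$, and null if it is simple and $\Omega\cdot\Omega=0$. Let $\mathcal{SS}$ (resp. $\mathcal{NS}$) be the set of superenergy tensors of simple (resp. null) $p$-forms, $1\le p\le N$, and $-\mathcal{SS}$, $-\mathcal{NS}$ the sets of their negatives. Write $(T\times T)_{ab}=T_{ac}T_b{}^c$. A tensor $T_a{}^b$ is identified with the linear map $k^a\mapsto k^aT_a{}^b$. It is null-cone preserving if it maps every null vector to a null vector (the zero vector being allowed as an image), and bi-preserving if moreover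 $k_b\mapsto T_a{}^bk_b$ does the same for null 1-forms. A null-cone preserving map is orthochronous (resp. time-reversal) if it sends every future-pointing null vector to a vector which is zero or future-pointing (resp. zero or past-pointing); it is singular if its determinant is $0$. A Lorentz transformation is a linear isometry of $g$, and it is involutory if it equals its inverse. (i) Let $T_{ab}$ be symmetric. If $N\ge 3$, then $(T\times T)_{ab}=f g_{ab}$ for some real $f$ if and only if $T=0$ or $T\in\mathcal{SS}\cup-\mathcal{SS}$. If $N=2$, the same equivalence holds with the additional requirement $f\ge 0$. (ii) A tensor $T_{ab}$ is in $\mathcal{SS}\setminus\mathcal{NS}$ (resp. $-\mathcal{SS}\setminus-\mathcal{NS}$) if and only if $T_a{}^b=c\,L_a{}^b$ with $c>0$ and $L$ an involutory orthochronous (resp. time-reversal) Lorentz transformation. (iii) A tensor $T_{ab}$ is in $\mathcal{NS}$ (resp. $-\mathcal{NS}$) if and only if it is non-zero and symmetric and $T_a{}^b$ is a singular orthochronous (resp. time-reversal) null-cone bi-preserving map. -/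

import Mathlib

open LinearMap (BilinForm)
open Module (Dual Basis finrank finBasis)

noncomputable section

/-- A Lorentzian metric `g_ab` on a real vector space (the tangent space at a point), with signature
`(+,-,…,-)`: some basis is orthonormal, its first vector being timelike. -/
structure LorentzMetric (V : Type*) [AddCommGroup V] [Module ℝ V] where
  form : BilinForm ℝ V
  exists_orthonormal : ∃ (n : ℕ) (e : Basis (Fin (n + 1)) ℝ V),
    ∀ i j, form (e i) (e j) = if i = j then (if i = 0 then 1 else -1) else 0

namespace LorentzMetric

variable {V : Type*} [AddCommGroup V] [Module ℝ V]

theorem nondegenerate (g : LorentzMetric V) : g.form.Nondegenerate := by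
  obtain ⟨n, e, he⟩ := g.exists_orthonormal
  have hs : ∀ x y, g.form x y = g.form y x := by
    intro x y
    have h : g.form = LinearMap.flip g.form := by
      refine e.ext fun i => e.ext fun j => ?_
      rw [LinearMap.flip_apply, he, he]
      by_cases h : i = j
      · subst h; rfl
      · rw [if_neg h, if_neg (Ne.symm h)]
    exact congrArg (fun B : BilinForm ℝ V => B x y) h
  have key : ∀ x, (∀ y, g.form x y = 0) → x = 0 := by
    intro x hx
    refine (Basis.ext_elem_iff e).2 fun j => ?_
    have h := hx (e j)
    rw [← e.sum_repr x] at h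
    simp only [map_sum, map_smul, LinearMap.sum_apply, LinearMap.smul_apply, smul_eq_mul, he,
      mul_ite, mul_zero, Finset.sum_ite_eq', Finset.mem_univ, if_true] at h
    rw [map_zero, Finsupp.zero_apply]
    split_ifs at h <;> linarith
  exact ⟨key, fun x hx => key x fun y => by rw [hs]; exact hx y⟩

variable [FiniteDimensional ℝ V]

/-- Raising the index of a 1-form: `g (sharp α) y = α y`. -/
def sharp (g : LorentzMetric V) : Dual ℝ V ≃ₗ[ℝ] V :=
  (BilinForm.toDual g.form g.nondegenerate).symm

/-- The linear map `k^a ↦ k^a T_a{}^b` defined by a rank-2 tensor `T_ab`. -/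
def toMap (g : LorentzMetric V) (T : BilinForm ℝ V) : V →ₗ[ℝ] V :=
  g.sharp.toLinearMap ∘ₗ T

/-- The product `(S × T)_ab = S_ac T_b{}^c`. -/
def cross (g : LorentzMetric V) (S T : BilinForm ℝ V) : BilinForm ℝ V :=
  BilinForm.compRight S (g.toMap T)

/-- The full contraction `A_{c₁…c_p} B^{c₁…c_p}` of two `p`-forms; the indices of `B` are raised by
evaluating it on the `g`-reciprocal basis. -/
def contract (g : LorentzMetric V) {p : ℕ} (A B : V [⋀^Fin p]→ₗ[ℝ] ℝ) : ℝ :=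
  ∑ c : Fin p → Fin (finrank ℝ V),
    A (fun i => finBasis ℝ V (c i)) *
      B (fun i => BilinForm.dualBasis g.form g.nondegenerate (finBasis ℝ V) (c i))

/-- The superenergy tensor of a `p`-form `Ω`, where `p = q + 1 ≥ 1`:
`T_ab{Ω} = ((-1)^(p-1) / (p-1)!) [Ω_{a a₂…a_p} Ω_b{}^{a₂…a_p} - (1/(2p)) (Ω · Ω) g_ab]`. -/
def superenergy (g : LorentzMetric V) {q : ℕ} (Ω : V [⋀^Fin (q + 1)]→ₗ[ℝ] ℝ) : BilinForm ℝ V :=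
  LinearMap.mk₂ ℝ
    (fun x y => ((-1 : ℝ) ^ q / (q.factorial : ℝ)) *
      (g.contract (Ω.curryLeft x) (Ω.curryLeft y)
        - 1 / (2 * ((q : ℝ) + 1)) * g.contract Ω Ω * g.form x y))
    (fun x x' y => by
      simp only [contract, map_add, AlternatingMap.add_apply, LinearMap.add_apply, add_mul,
        Finset.sum_add_distrib]
      ring)
    (fun a x y => by
      simp only [contract, map_smul, AlternatingMap.smul_apply, LinearMap.smul_apply, smul_eq_mul,
        mul_assoc, ← Finset.mul_sum]
      ring)
    (fun x y y' => by
      simp only [contract, map_add, AlternatingMap.add_apply, mul_add,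
        Finset.sum_add_distrib]
      ring)
    (fun a x y => by
      simp only [contract, map_smul, AlternatingMap.smul_apply, smul_eq_mul,
        mul_left_comm _ a, ← Finset.mul_sum]
      ring)

end LorentzMetric

/-- The exterior product `ω¹ ∧ … ∧ ω^p` of 1-forms: `(v₁, …, v_p) ↦ det (ω^i (v_j))`. -/
def wedge {V : Type*} [AddCommGroup V] [Module ℝ V] {p : ℕ} (ω : Fin p → Dual ℝ V) :
    V [⋀^Fin p]→ₗ[ℝ] ℝ :=
  (Matrix.detRowAlternating : (Fin p → ℝ) [⋀^Fin p]→ₗ[ℝ] ℝ).compLinearMap (LinearMap.pi ω)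

/-- A `p`-form is simple if it is the exterior product of `p` linearly independent 1-forms. -/
def IsSimpleForm {V : Type*} [AddCommGroup V] [Module ℝ V] {p : ℕ}
    (Ω : V [⋀^Fin p]→ₗ[ℝ] ℝ) : Prop :=
  ∃ ω : Fin p → Dual ℝ V, LinearIndependent ℝ ω ∧ Ω = wedge ω

namespace LorentzMetric

variable {V : Type*} [AddCommGroup V] [Module ℝ V] [FiniteDimensional ℝ V]

/-- A form is null if it is simple and `Ω · Ω = 0`. -/
def IsNullForm (g : LorentzMetric V) {p : ℕ} (Ω : V [⋀^Fin p]→ₗ[ℝ] ℝ) : Prop :=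
  IsSimpleForm Ω ∧ g.contract Ω Ω = 0

/-- The set of superenergy tensors of simple `p`-forms, `p ≥ 1`. -/
def SS (g : LorentzMetric V) : Set (BilinForm ℝ V) :=
  {T | ∃ (q : ℕ) (Ω : V [⋀^Fin (q + 1)]→ₗ[ℝ] ℝ), IsSimpleForm Ω ∧ T = g.superenergy Ω}

/-- The set of superenergy tensors of null `p`-forms, `p ≥ 1`. -/
def NS (g : LorentzMetric V) : Set (BilinForm ℝ V) :=
  {T | ∃ (q : ℕ) (Ω : V [⋀^Fin (q + 1)]→ₗ[ℝ] ℝ), g.IsNullForm Ω ∧ T = g.superenergy Ω}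

/-- `A` maps null vectors to null vectors; the image may be the zero vector, which a singular map
cannot avoid. -/
def IsNullConePreserving (g : LorentzMetric V) (A : V →ₗ[ℝ] V) : Prop :=
  ∀ k, g.form k k = 0 → g.form (A k) (A k) = 0

/-- Moreover the transposed map `k_b ↦ A_a{}^b k_b` sends null 1-forms to null 1-forms. -/
def IsNullConeBiPreserving (g : LorentzMetric V) (A : V →ₗ[ℝ] V) : Prop :=
  g.IsNullConePreserving A ∧
    ∀ κ : Dual ℝ V, g.form (g.sharp κ) (g.sharp κ) = 0 →
      g.form (g.sharp (κ ∘ₗ A)) (g.sharp (κ ∘ₗ A)) = 0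

/-- `A` preserves the null cone and its time orientation. The time orientation is the one in which
the timelike vector `t` is future-pointing: a non-zero causal vector `v` is future-pointing iff
`g t v > 0`, and past-pointing iff `g t v < 0`. -/
def IsOrthochronous (g : LorentzMetric V) (t : V) (A : V →ₗ[ℝ] V) : Prop :=
  g.IsNullConePreserving A ∧
    ∀ k, g.form k k = 0 → 0 < g.form t k → A k = 0 ∨ 0 < g.form t (A k)

/-- `A` preserves the null cone and reverses its time orientation. -/
def IsTimeReversal (g : LorentzMetric V) (t : V) (A : V →ₗ[ℝ] V) : Prop :=
  g.IsNullConePreserving A ∧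
    ∀ k, g.form k k = 0 → 0 < g.form t k → A k = 0 ∨ g.form t (A k) < 0

/-- Lorentz transformations: linear isometries of the metric. -/
def IsLorentzTransformation (g : LorentzMetric V) (L : V →ₗ[ℝ] V) : Prop :=
  ∀ x y, g.form (L x) (L y) = g.form x y

end LorentzMetric

/-- `L` is its own inverse. -/
def IsInvolutory {V : Type*} [AddCommGroup V] [Module ℝ V] (L : V →ₗ[ℝ] V) : Prop :=
  L ∘ₗ L = LinearMap.id

end

/-!
Write `Ω = w₁♭ ∧ … ∧ w_p♭` and let `A` be the linear map of `T{Ω}`. Expanding by cofactors of the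
Gram matrix `G = (g (wᵢ, wⱼ))` shows that, with `μ = (-1)^(p-1) det G / 2`, `A` acts as `μ` on the
span of the `wᵢ` and as `-μ` on its orthogonal complement, which contains the range of `A - μ`.
Hence `(A + μ) (A - μ) = 0`, that is `T × T = μ² g`. Moreover, for `t` timelike, the matrix
determinant lemma turns `T{Ω}(t, t)` into `g(t, t) / 2` times the Gram determinant of the `wᵢ` for
the positive definite form obtained by reversing the sign of `g` on `t^⊥`, so it is positive.

Conversely let `T × T = f g` with `T ≠ 0`. If `N ≥ 3`, some spacelike `x` is orthogonal to `t` and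
has an image orthogonal to `t`, so `f ≥ 0`. Then `T(t, t) ≠ 0`, and we may take it positive. If
`f > 0`, then `T` is a positive multiple of the superenergy tensor of the volume form of its
`√f`-eigenspace. If `f = 0`, the range of `T` is totally null, hence a line, and `T` is the square
of a null 1-form.

Since a symmetric tensor vanishing on the null cone is a multiple of `g`, null-cone preserving maps
also satisfy `T × T = f g`, with `f = 0` exactly when they are singular.
-/

section GramMatrix

theorem det_add_vecMulVec {R n : Type*} [CommRing R] [Fintype n] [DecidableEq n]
    (A : Matrix n n R) (u v : n → R) :
    (A + Matrix.vecMulVec u v).det = A.det + v ⬝ᵥ A.adjugate.mulVec u := by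
  -- `A` may be singular, so the rank-one term is added one row at a time.
  suffices partialSum : ∀ s : Finset n,
      (Matrix.of fun i => A i + if i ∈ s then u i • v else 0).det =
        A.det + ∑ i ∈ s, u i * (A.updateRow i v).det by
    have hrows : A + Matrix.vecMulVec u v =
        Matrix.of fun i => A i + if i ∈ Finset.univ then u i • v else 0 := by
      ext i j
      simp [Matrix.vecMulVec_apply]
    rw [hrows, partialSum, Matrix.dotProduct_mulVec, ← Matrix.mulVec_transpose,
      Matrix.adjugate_transpose, ← Matrix.cramer_eq_adjugate_mulVec, dotProduct_comm]
    simp only [dotProduct, Matrix.cramer_transpose_apply]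
  intro s
  induction s using Finset.induction_on with
  | empty =>
    rw [Finset.sum_empty, add_zero]
    exact congrArg Matrix.det (Matrix.ext fun i j => by simp)
  | insert k s hk ih =>
    set M : Matrix n n R := Matrix.of fun i => A i + if i ∈ s then u i • v else 0 with hM
    have hinsert : (Matrix.of fun i => A i + if i ∈ insert k s then u i • v else 0) =
        M.updateRow k (M k + u k • v) := by
      ext i j
      rcases eq_or_ne i k with rfl | hik
      · simp [hM, hk]
      · simp [hM, hik]
    have hrow : (M.updateRow k v).det = (A.updateRow k v).det := by
      refine Matrix.det_eq_of_forall_row_eq_smul_add_const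
        (fun i => if i ∈ s then u i else 0) k (if_neg hk) fun i j => ?_
      rcases eq_or_ne i k with rfl | hik
      · simp [hk]
      · by_cases his : i ∈ s <;> simp [hM, hik, his]
    rw [hinsert, Matrix.det_updateRow_add, Matrix.updateRow_eq_self, Matrix.det_updateRow_smul,
      hrow, ih, Finset.sum_insert hk]
    ring

/-- The Gram matrix `B(wᵢ, wⱼ)` of a family of vectors with respect to an arbitrary bilinear form;
`Matrix.gram` is the case of an inner product. -/
def gramMatrix {R M ι : Type*} [CommSemiring R] [AddCommMonoid M] [Module R M]
    (B : BilinForm R M) (w : ι → M) : Matrix ι ι R :=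
  Matrix.of fun i j => B (w i) (w j)

variable {R M ι : Type*} [CommSemiring R] [AddCommMonoid M] [Module R M] {B : BilinForm R M}

theorem gramMatrix_apply (w : ι → M) (i j : ι) : gramMatrix B w i j = B (w i) (w j) := rfl

theorem isSymm_gramMatrix (hB : B.IsSymm) (w : ι → M) : (gramMatrix B w).IsSymm :=
  Matrix.IsSymm.ext fun _ _ => hB.eq _ _

theorem dotProduct_gramMatrix_mulVec [Fintype ι] (w : ι → M) (x y : ι → R) :
    x ⬝ᵥ (gramMatrix B w).mulVec y = B (∑ i, x i • w i) (∑ j, y j • w j) := by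
  simp only [dotProduct, Matrix.mulVec, gramMatrix_apply, map_sum, map_smul, LinearMap.sum_apply,
    LinearMap.smul_apply, smul_eq_mul, Finset.mul_sum]
  rw [Finset.sum_comm]
  exact Finset.sum_congr rfl fun j _ => Finset.sum_congr rfl fun i _ => by ring

theorem posDef_gramMatrix {V : Type*} [AddCommGroup V] [Module ℝ V] [Finite ι]
    {B : BilinForm ℝ V} (hB : B.IsSymm) (hpos : ∀ x, x ≠ 0 → 0 < B x x) {w : ι → V}
    (hw : LinearIndependent ℝ w) : (gramMatrix B w).PosDef := by
  have := Fintype.ofFinite ι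
  refine Matrix.PosDef.of_dotProduct_mulVec_pos (isSymm_gramMatrix hB w) fun x hx => ?_
  rw [star_trivial, dotProduct_gramMatrix_mulVec]
  exact hpos _ fun h => hx (funext (Fintype.linearIndependent_iff.1 hw x h))

end GramMatrix

namespace LorentzMetric

section Causality

variable {V : Type*} [AddCommGroup V] [Module ℝ V] (g : LorentzMetric V) {t x y : V}

theorem isSymm_form : g.form.IsSymm := by
  obtain ⟨n, e, he⟩ := g.exists_orthonormal
  refine LinearMap.BilinForm.isSymm_iff.2 ((LinearMap.isSymm_iff_basis e).2 fun i j => ?_)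
  rcases eq_or_ne i j with rfl | hij
  · rfl
  · simp [he, hij, hij.symm]

theorem form_comm (x y : V) : g.form x y = g.form y x :=
  g.isSymm_form.eq x y

theorem ext_form (h : ∀ z, g.form x z = g.form y z) : x = y :=
  LinearMap.ker_eq_bot.1 (LinearMap.separatingLeft_iff_ker_eq_bot.1 g.nondegenerate.1)
    (LinearMap.ext h)

theorem form_ne_zero (ht : 0 < g.form t t) : g.form ≠ 0 := by
  intro h
  simp [h] at ht

theorem exists_ker_negDef : ∃ τ : Dual ℝ V, ∀ x, τ x = 0 → x ≠ 0 → g.form x x < 0 := by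
  obtain ⟨n, e, he⟩ := g.exists_orthonormal
  refine ⟨e.coord 0, fun x hx h0 => ?_⟩
  rw [Basis.coord_apply] at hx
  obtain ⟨i, hi⟩ : ∃ i : Fin n, e.repr x i.succ ≠ 0 := by
    by_contra! h
    exact h0 (e.ext_elem fun i => by rw [map_zero]; exact Fin.cases hx h i)
  have hform : g.form x x = -∑ i : Fin n, e.repr x i.succ ^ 2 := by
    conv_lhs => rw [← e.sum_repr x]
    simp only [map_sum, map_smul, LinearMap.sum_apply, LinearMap.smul_apply, smul_eq_mul, he,
      mul_ite, mul_zero, Finset.sum_ite_eq', Finset.mem_univ, if_true]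
    simp [Fin.sum_univ_succ, hx, pow_two]
  rw [hform, neg_lt_zero]
  exact Finset.sum_pos' (fun _ _ => sq_nonneg _) ⟨i, Finset.mem_univ i, by positivity⟩

theorem form_self_neg (ht : 0 < g.form t t) (hx : g.form t x = 0) (h0 : x ≠ 0) :
    g.form x x < 0 := by
  obtain ⟨τ, hτ⟩ := g.exists_ker_negDef
  -- Eliminating the time components of `x` and `t` leaves a spacelike combination.
  have hτy : τ (τ t • x - τ x • t) = 0 := by
    simp only [map_sub, map_smul, smul_eq_mul]
    ring
  have hform : g.form (τ t • x - τ x • t) (τ t • x - τ x • t) =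
      τ t ^ 2 * g.form x x + τ x ^ 2 * g.form t t := by
    simp only [map_sub, map_smul, LinearMap.sub_apply, LinearMap.smul_apply, smul_eq_mul,
      g.form_comm x t, hx]
    ring
  rcases eq_or_ne (τ x) 0 with hτx | hτx
  · exact hτ x hτx h0
  have hy : τ t • x - τ x • t ≠ 0 := by
    intro h
    have := congrArg (g.form t) h
    simp [hx, hτx, ht.ne'] at this
  have hneg := hform ▸ hτ _ hτy hy
  have : 0 < τ x ^ 2 * g.form t t := by positivity
  exact neg_of_mul_neg_right (by linarith) (sq_nonneg (τ t))

theorem form_self_nonpos (ht : 0 < g.form t t) (hx : g.form t x = 0) : g.form x x ≤ 0 := by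
  rcases eq_or_ne x 0 with rfl | h0
  · simp
  · exact (g.form_self_neg ht hx h0).le

theorem eq_zero_of_orthogonal_of_nonneg (ht : 0 < g.form t t) (hx : g.form t x = 0)
    (h : 0 ≤ g.form x x) : x = 0 := by
  by_contra h0
  exact (g.form_self_neg ht hx h0).not_ge h

theorem exists_eq_smul_add_orthogonal (ht : g.form t t ≠ 0) (x : V) :
    ∃ (a : ℝ) (v : V), g.form t v = 0 ∧ x = a • t + v := by
  refine ⟨g.form t x / g.form t t, x - (g.form t x / g.form t t) • t, ?_, by abel⟩
  rw [map_sub, map_smul, smul_eq_mul, div_mul_cancel₀ _ ht, sub_self]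

/-- The form `2 g(t, ·) g(t, ·) / g(t, t) - g`, which agrees with `g` on the line of the timelike
vector `t` and with `-g` on its orthogonal complement. -/
noncomputable def wickRotation (t : V) : BilinForm ℝ V :=
  (2 / g.form t t) • BilinForm.linMulLin (g.form t) (g.form t) - g.form

theorem wickRotation_apply (t x y : V) :
    g.wickRotation t x y = 2 / g.form t t * (g.form t x * g.form t y) - g.form x y := rfl

theorem isSymm_wickRotation (t : V) : (g.wickRotation t).IsSymm :=
  ⟨fun x y => by
    rw [wickRotation_apply, wickRotation_apply, g.form_comm x y, mul_comm (g.form t x)]⟩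

theorem wickRotation_self_pos (ht : 0 < g.form t t) (h0 : x ≠ 0) : 0 < g.wickRotation t x x := by
  obtain ⟨a, v, hv, rfl⟩ := g.exists_eq_smul_add_orthogonal ht.ne' x
  have hform : g.wickRotation t (a • t + v) (a • t + v) = a ^ 2 * g.form t t - g.form v v := by
    simp only [wickRotation_apply, map_add, map_smul, LinearMap.add_apply, LinearMap.smul_apply,
      smul_eq_mul, g.form_comm v t, hv]
    field_simp
    ring
  rw [hform]
  rcases eq_or_ne v 0 with rfl | hv0
  · have ha : a ≠ 0 := by rintro rfl; simp at h0
    simp only [map_zero, sub_zero]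
    positivity
  · have := g.form_self_neg ht hv hv0
    have : 0 ≤ a ^ 2 * g.form t t := by positivity
    linarith

theorem form_nonneg_of_future_causal (ht : 0 < g.form t t) (hx : 0 ≤ g.form x x)
    (hy : 0 ≤ g.form y y) (htx : 0 < g.form t x) (hty : 0 < g.form t y) : 0 ≤ g.form x y := by
  have horth : g.form t (g.form t y • x - g.form t x • y) = 0 := by
    simp only [map_sub, map_smul, smul_eq_mul]
    ring
  have hle := g.form_self_nonpos ht horth
  simp only [map_sub, map_smul, LinearMap.sub_apply, LinearMap.smul_apply, smul_eq_mul,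
    g.form_comm y x] at hle
  have hxx := mul_nonneg (sq_nonneg (g.form t y)) hx
  have hyy := mul_nonneg (sq_nonneg (g.form t x)) hy
  refine nonneg_of_mul_nonneg_right (?_ : 0 ≤ g.form t x * g.form t y * g.form x y)
    (mul_pos htx hty)
  linarith

theorem exists_null_smul_add_sub (ht : 0 < g.form t t) (hx : g.form t x = 0) (h0 : x ≠ 0) :
    ∃ r : ℝ, 0 < r ∧ g.form (r • t + x) (r • t + x) = 0 ∧ g.form (r • t - x) (r • t - x) = 0 := by
  have hneg := g.form_self_neg ht hx h0
  have hratio : 0 < -g.form x x / g.form t t := div_pos (neg_pos.2 hneg) ht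
  have hsq : √(-g.form x x / g.form t t) ^ 2 * g.form t t = -g.form x x := by
    rw [Real.sq_sqrt hratio.le, div_mul_cancel₀ _ ht.ne']
  refine ⟨√(-g.form x x / g.form t t), Real.sqrt_pos.2 hratio, ?_, ?_⟩ <;>
  · simp only [map_add, map_sub, map_smul, LinearMap.add_apply, LinearMap.sub_apply,
      LinearMap.smul_apply, smul_eq_mul, g.form_comm x t, hx]
    linear_combination hsq

theorem exists_future_null_add_eq [FiniteDimensional ℝ V] (hN : 2 ≤ finrank ℝ V)
    (ht : 0 < g.form t t) :
    ∃ k l, g.form k k = 0 ∧ g.form l l = 0 ∧ 0 < g.form t k ∧ 0 < g.form t l ∧ k + l = t := by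
  have hker := LinearMap.ker_ne_bot_of_finrank_lt (f := g.form t)
    (by rw [Module.finrank_self]; omega)
  obtain ⟨x, hx, h0⟩ := (Submodule.ne_bot_iff _).1 hker
  rw [LinearMap.mem_ker] at hx
  obtain ⟨r, hr, hplus, hminus⟩ := g.exists_null_smul_add_sub ht hx h0
  refine ⟨(2 * r)⁻¹ • (r • t + x), (2 * r)⁻¹ • (r • t - x), ?_, ?_, ?_, ?_, ?_⟩
  · rw [map_smul, map_smul, LinearMap.smul_apply, hplus, smul_zero, smul_zero]
  · rw [map_smul, map_smul, LinearMap.smul_apply, hminus, smul_zero, smul_zero]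
  · simp only [map_smul, map_add, smul_eq_mul, hx, add_zero]
    positivity
  · simp only [map_smul, map_sub, smul_eq_mul, hx, sub_zero]
    positivity
  · rw [← smul_add, add_add_sub_cancel, ← two_smul ℝ, smul_smul, smul_smul, mul_assoc,
      inv_mul_cancel₀ (by positivity), one_smul]

theorem apply_eq_zero_of_null (ht : 0 < g.form t t) {P : BilinForm ℝ V} (hP : P.IsSymm)
    (hPt : P t t = 0) (h : ∀ k, g.form k k = 0 → P k k = 0) : P = 0 := by
  refine LinearMap.BilinForm.ext_of_isSymm hP LinearMap.BilinForm.isSymm_zero fun x => ?_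
  obtain ⟨a, v, hv, rfl⟩ := g.exists_eq_smul_add_orthogonal ht.ne' x
  rcases eq_or_ne v 0 with rfl | hv0
  · simp [hPt]
  obtain ⟨r, hr, hplus, hminus⟩ := g.exists_null_smul_add_sub ht hv hv0
  have hPplus := h _ hplus
  have hPminus := h _ hminus
  simp only [map_add, map_sub, map_smul, LinearMap.add_apply, LinearMap.sub_apply,
    LinearMap.smul_apply, smul_eq_mul, hPt, hP.eq v t] at hPplus hPminus
  have hPv : P v v = 0 := by linarith
  have hPtv : P t v = 0 := (mul_eq_zero.1 (by linarith : r * P t v = 0)).resolve_left hr.ne'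
  simp [hPt, hPv, hPtv, hP.eq v t]

theorem eq_smul_form_of_null (ht : 0 < g.form t t) {Q : BilinForm ℝ V} (hQ : Q.IsSymm)
    (h : ∀ k, g.form k k = 0 → Q k k = 0) : ∃ f : ℝ, Q = f • g.form := by
  refine ⟨Q t t / g.form t t, sub_eq_zero.1 (g.apply_eq_zero_of_null ht ?_ ?_ fun k hk => ?_)⟩
  · exact hQ.sub ⟨fun x y => by simp [g.form_comm x y]⟩
  · simp [ht.ne']
  · simp [h k hk, hk]

end Causality

end LorentzMetric

section Wedge

theorem alternatingMap_sum_apply {R M N ι κ : Type*} [Semiring R] [AddCommMonoid M] [Module R M]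
    [AddCommMonoid N] [Module R N] (s : Finset κ) (A : κ → M [⋀^ι]→ₗ[R] N) (v : ι → M) :
    (∑ i ∈ s, A i) v = ∑ i ∈ s, A i v :=
  map_sum (⟨⟨fun A => A v, rfl⟩, fun _ _ => rfl⟩ : (M [⋀^ι]→ₗ[R] N) →+ N) A s

variable {V : Type*} [AddCommGroup V] [Module ℝ V]

theorem wedge_smul {p : ℕ} (a : Fin p → ℝ) (ω : Fin p → Dual ℝ V) :
    wedge (fun i => a i • ω i) = (∏ i, a i) • wedge ω := by
  ext v
  exact Matrix.det_mul_row a (Matrix.of fun j i => ω i (v j))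

theorem isSimpleForm_smul {q : ℕ} {Ω : V [⋀^Fin (q + 1)]→ₗ[ℝ] ℝ} (hΩ : IsSimpleForm Ω) {a : ℝ}
    (ha : a ≠ 0) : IsSimpleForm (a • Ω) := by
  obtain ⟨ω, hω, rfl⟩ := hΩ
  let u : Fin (q + 1) → ℝˣ := Pi.mulSingle 0 (Units.mk0 a ha)
  have hprod : ∏ i, (u i : ℝ) = a := by
    rw [← Units.coe_prod, Finset.prod_pi_mulSingle', if_pos (Finset.mem_univ _), Units.val_mk0]
  refine ⟨_, hω.units_smul u, ?_⟩
  rw [← hprod, ← wedge_smul]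
  rfl

end Wedge

namespace LorentzMetric

section SimpleForms

variable {V : Type*} [AddCommGroup V] [Module ℝ V] (g : LorentzMetric V) {p q : ℕ}

/-- The simple form `w₁♭ ∧ … ∧ w_p♭`, whose factors are the vectors `wᵢ` with lowered index. -/
noncomputable def wedgeFlat (w : Fin p → V) : V [⋀^Fin p]→ₗ[ℝ] ℝ :=
  wedge fun i => g.form (w i)

theorem wedgeFlat_apply (w v : Fin p → V) :
    g.wedgeFlat w v = (Matrix.of fun i j => g.form (w i) (v j)).det := by
  rw [← Matrix.det_transpose]
  rfl

theorem curryLeft_wedgeFlat (w : Fin (q + 1) → V) (x : V) :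
    (g.wedgeFlat w).curryLeft x =
      ∑ i : Fin (q + 1), ((-1) ^ (i : ℕ) * g.form (w i) x) • g.wedgeFlat (w ∘ i.succAbove) := by
  refine AlternatingMap.ext fun v => ?_
  rw [AlternatingMap.curryLeft_apply_apply, wedgeFlat_apply, Matrix.det_succ_column_zero,
    alternatingMap_sum_apply]
  refine Finset.sum_congr rfl fun i _ => ?_
  rw [AlternatingMap.smul_apply, wedgeFlat_apply]
  rfl

theorem sum_form_smul_dualBasis {ι : Type*} [Fintype ι] [DecidableEq ι] (b : Basis ι ℝ V) (x : V) :
    ∑ c, g.form x (b c) • BilinForm.dualBasis g.form g.nondegenerate b c = x := by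
  conv_rhs => rw [← (BilinForm.dualBasis g.form g.nondegenerate b).sum_repr x]
  simp only [BilinForm.dualBasis_repr_apply]

theorem alternatingMap_apply_eq_sum_dualBasis {ι : Type*} [Fintype ι] [DecidableEq ι]
    (b : Basis ι ℝ V) (B : V [⋀^Fin p]→ₗ[ℝ] ℝ) (v : Fin p → V) :
    B v = ∑ c : Fin p → ι, (∏ i, g.form (v i) (b (c i))) *
      B fun i => BilinForm.dualBasis g.form g.nondegenerate b (c i) := by
  conv_lhs => rw [← funext fun i => g.sum_form_smul_dualBasis b (v i)]
  rw [← AlternatingMap.coe_multilinearMap, MultilinearMap.map_sum]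
  exact Finset.sum_congr rfl fun c _ => by rw [MultilinearMap.map_smul_univ, smul_eq_mul]

variable [FiniteDimensional ℝ V]

theorem form_sharp (α : Dual ℝ V) (y : V) : g.form (g.sharp α) y = α y :=
  BilinForm.apply_toDual_symm_apply ..

theorem isSimpleForm_iff_exists_wedgeFlat {Ω : V [⋀^Fin p]→ₗ[ℝ] ℝ} :
    IsSimpleForm Ω ↔ ∃ w : Fin p → V, LinearIndependent ℝ w ∧ Ω = g.wedgeFlat w := by
  constructor
  · rintro ⟨ω, hω, rfl⟩
    refine ⟨fun i => g.sharp (ω i), hω.map' g.sharp.toLinearMap g.sharp.ker,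
      congrArg wedge (funext fun i => ?_)⟩
    exact LinearMap.ext fun y => (g.form_sharp _ y).symm
  · rintro ⟨w, hw, rfl⟩
    exact ⟨_, hw.map' g.form (LinearMap.separatingLeft_iff_ker_eq_bot.1 g.nondegenerate.1), rfl⟩

theorem contract_smul_smul (a b : ℝ) (A B : V [⋀^Fin p]→ₗ[ℝ] ℝ) :
    g.contract (a • A) (b • B) = a * b * g.contract A B := by
  simp only [contract, AlternatingMap.smul_apply, smul_eq_mul, Finset.mul_sum]
  exact Finset.sum_congr rfl fun c _ => by ring

theorem contract_sum_smul_left {ι : Type*} (s : Finset ι) (a : ι → ℝ)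
    (A : ι → V [⋀^Fin p]→ₗ[ℝ] ℝ) (B : V [⋀^Fin p]→ₗ[ℝ] ℝ) :
    g.contract (∑ i ∈ s, a i • A i) B = ∑ i ∈ s, a i * g.contract (A i) B := by
  simp only [contract, alternatingMap_sum_apply, AlternatingMap.smul_apply, smul_eq_mul,
    Finset.sum_mul, Finset.mul_sum, mul_assoc]
  exact Finset.sum_comm

theorem contract_wedgeFlat (w : Fin p → V) (B : V [⋀^Fin p]→ₗ[ℝ] ℝ) :
    g.contract (g.wedgeFlat w) B = p.factorial * B w := by
  have hperm : ∀ σ : Equiv.Perm (Fin p), ((Equiv.Perm.sign σ : ℤ) : ℝ) * B (w ∘ σ) = B w := by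
    intro σ
    rw [B.map_perm, Units.smul_def, zsmul_eq_mul, ← mul_assoc, ← Int.cast_mul, ← Units.val_mul,
      Int.units_mul_self, Units.val_one, Int.cast_one, one_mul]
  simp only [contract, wedgeFlat_apply, Matrix.det_apply', Matrix.of_apply, Finset.sum_mul]
  rw [Finset.sum_comm]
  calc _ = ∑ σ : Equiv.Perm (Fin p), ((Equiv.Perm.sign σ : ℤ) : ℝ) * B (w ∘ σ) := by
        refine Finset.sum_congr rfl fun σ _ => ?_
        rw [g.alternatingMap_apply_eq_sum_dualBasis (finBasis ℝ V) B (w ∘ σ), Finset.mul_sum]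
        exact Finset.sum_congr rfl fun c _ => mul_assoc ..
    _ = p.factorial * B w := by
        simp only [hperm, Finset.sum_const, Finset.card_univ, Fintype.card_perm, Fintype.card_fin,
          nsmul_eq_mul]

theorem contract_wedgeFlat_self (w : Fin p → V) :
    g.contract (g.wedgeFlat w) (g.wedgeFlat w) = p.factorial * (gramMatrix g.form w).det := by
  rw [contract_wedgeFlat, wedgeFlat_apply]
  rfl

theorem contract_curryLeft_wedgeFlat (w : Fin (q + 1) → V) (x y : V) :
    g.contract ((g.wedgeFlat w).curryLeft x) ((g.wedgeFlat w).curryLeft y) =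
      q.factorial * ((fun i => g.form (w i) x) ⬝ᵥ
        (gramMatrix g.form w).adjugate.mulVec fun i => g.form (w i) y) := by
  rw [curryLeft_wedgeFlat g w x, contract_sum_smul_left, dotProduct, Finset.mul_sum]
  refine Finset.sum_congr rfl fun i _ => ?_
  rw [contract_wedgeFlat, curryLeft_wedgeFlat, alternatingMap_sum_apply, Matrix.mulVec, dotProduct]
  simp only [AlternatingMap.smul_apply, smul_eq_mul, wedgeFlat_apply, Finset.mul_sum]
  refine Finset.sum_congr rfl fun j _ => ?_
  rw [Matrix.adjugate_fin_succ_eq_det_submatrix, pow_add]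
  simp only [Matrix.submatrix, gramMatrix_apply, Function.comp_apply]
  ring

theorem superenergy_wedgeFlat_apply (w : Fin (q + 1) → V) (x y : V) :
    g.superenergy (g.wedgeFlat w) x y =
      (-1) ^ q * ((fun i => g.form (w i) x) ⬝ᵥ
        ((gramMatrix g.form w).adjugate.mulVec fun i => g.form (w i) y) -
          (gramMatrix g.form w).det / 2 * g.form x y) := by
  rw [superenergy, LinearMap.mk₂_apply, contract_curryLeft_wedgeFlat, contract_wedgeFlat_self,
    Nat.factorial_succ]
  have hfactorial : (q.factorial : ℝ) ≠ 0 := Nat.cast_ne_zero.2 q.factorial_ne_zero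
  push_cast
  field_simp

theorem isSymm_superenergy_wedgeFlat (w : Fin (q + 1) → V) :
    (g.superenergy (g.wedgeFlat w)).IsSymm := by
  refine BilinForm.isSymm_iff.2 ⟨fun x y => ?_⟩
  rw [RingHom.id_apply, superenergy_wedgeFlat_apply, superenergy_wedgeFlat_apply,
    g.form_comm x y, Matrix.dotProduct_mulVec, ← Matrix.mulVec_transpose,
    ((isSymm_gramMatrix g.isSymm_form w).adjugate).eq, dotProduct_comm]

/-- The eigenvalue `± det (g (wᵢ, wⱼ)) / 2` of the superenergy tensor of `w₁♭ ∧ … ∧ w_p♭` on the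
span of the `wᵢ`; its eigenvalue on the orthogonal complement is the opposite number. -/
noncomputable def factorEigenvalue (w : Fin (q + 1) → V) : ℝ :=
  (-1) ^ q * ((gramMatrix g.form w).det / 2)

theorem superenergy_wedgeFlat_factor (w : Fin (q + 1) → V) (x : V) (k : Fin (q + 1)) :
    g.superenergy (g.wedgeFlat w) x (w k) = g.factorEigenvalue w * g.form x (w k) := by
  have hcolumn : (fun i => g.form (w i) (w k)) = (gramMatrix g.form w).mulVec (Pi.single k 1) := by
    rw [Matrix.mulVec_single_one]
    rfl
  rw [superenergy_wedgeFlat_apply, hcolumn, Matrix.mulVec_mulVec, Matrix.adjugate_mul,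
    Matrix.smul_mulVec, Matrix.one_mulVec, dotProduct_smul, dotProduct_single, g.form_comm x,
    smul_eq_mul, factorEigenvalue]
  ring

theorem superenergy_wedgeFlat_of_mem_span {w : Fin (q + 1) → V} (x : V) {y : V}
    (hy : y ∈ Submodule.span ℝ (Set.range w)) :
    g.superenergy (g.wedgeFlat w) x y = g.factorEigenvalue w * g.form x y := by
  have heq : Set.EqOn (g.superenergy (g.wedgeFlat w) x) ((g.factorEigenvalue w • g.form) x)
      (Set.range w) := by
    rintro _ ⟨k, rfl⟩
    exact g.superenergy_wedgeFlat_factor w x k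
  exact LinearMap.eqOn_span heq hy

theorem superenergy_wedgeFlat_of_orthogonal {w : Fin (q + 1) → V} (x : V) {y : V}
    (hy : ∀ i, g.form (w i) y = 0) :
    g.superenergy (g.wedgeFlat w) x y = -(g.factorEigenvalue w * g.form x y) := by
  rw [superenergy_wedgeFlat_apply, funext hy, ← Pi.zero_def, Matrix.mulVec_zero, dotProduct_zero,
    factorEigenvalue]
  ring

theorem superenergy_wedgeFlat_self_self {t : V} (ht : g.form t t ≠ 0) (w : Fin (q + 1) → V) :
    g.superenergy (g.wedgeFlat w) t t =
      g.form t t / 2 * (gramMatrix (g.wickRotation t) w).det := by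
  set u : Fin (q + 1) → ℝ := fun i => g.form (w i) t with hu
  have hgram : gramMatrix (g.wickRotation t) w =
      -(gramMatrix g.form w + Matrix.vecMulVec ((-2 / g.form t t) • u) u) := by
    ext i j
    simp only [gramMatrix_apply, wickRotation_apply, Matrix.neg_apply, Matrix.add_apply,
      Matrix.vecMulVec_apply, Pi.smul_apply, smul_eq_mul, hu, g.form_comm t]
    ring
  rw [superenergy_wedgeFlat_apply, hgram, Matrix.det_neg, Fintype.card_fin, det_add_vecMulVec,
    Matrix.mulVec_smul, dotProduct_smul, smul_eq_mul]
  field_simp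
  ring

theorem superenergy_wedgeFlat_self_pos {t : V} (ht : 0 < g.form t t) {w : Fin (q + 1) → V}
    (hw : LinearIndependent ℝ w) : 0 < g.superenergy (g.wedgeFlat w) t t := by
  rw [g.superenergy_wedgeFlat_self_self ht.ne']
  exact mul_pos (half_pos ht) (posDef_gramMatrix (g.isSymm_wickRotation t)
    (fun _ => g.wickRotation_self_pos ht) hw).det_pos

theorem isNullForm_wedgeFlat_iff {w : Fin (q + 1) → V} (hw : LinearIndependent ℝ w) :
    g.IsNullForm (g.wedgeFlat w) ↔ g.factorEigenvalue w = 0 := by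
  rw [IsNullForm, and_iff_right (g.isSimpleForm_iff_exists_wedgeFlat.2 ⟨w, hw, rfl⟩),
    contract_wedgeFlat_self, factorEigenvalue]
  simp [Nat.factorial_ne_zero]

variable {g} {T : BilinForm ℝ V} {r : ℝ}

theorem superenergy_smul (a : ℝ) (Ω : V [⋀^Fin (q + 1)]→ₗ[ℝ] ℝ) :
    g.superenergy (a • Ω) = a ^ 2 • g.superenergy Ω := by
  refine LinearMap.ext₂ fun x y => ?_
  have hcurry : ∀ z, (a • Ω).curryLeft z = a • Ω.curryLeft z := fun _ => rfl
  simp only [superenergy, LinearMap.mk₂_apply, LinearMap.smul_apply, smul_eq_mul, hcurry,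
    contract_smul_smul]
  ring

theorem smul_mem_SS (hr : 0 < r) (hT : T ∈ g.SS) : r • T ∈ g.SS := by
  obtain ⟨q, Ω, hΩ, rfl⟩ := hT
  refine ⟨q, √r • Ω, isSimpleForm_smul hΩ (Real.sqrt_pos.2 hr).ne', ?_⟩
  rw [superenergy_smul, Real.sq_sqrt hr.le]

theorem smul_mem_NS (hr : 0 < r) (hT : T ∈ g.NS) : r • T ∈ g.NS := by
  obtain ⟨q, Ω, ⟨hΩ, hnull⟩, rfl⟩ := hT
  refine ⟨q, √r • Ω, ⟨isSimpleForm_smul hΩ (Real.sqrt_pos.2 hr).ne', ?_⟩, ?_⟩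
  · rw [contract_smul_smul, hnull, mul_zero]
  · rw [superenergy_smul, Real.sq_sqrt hr.le]

theorem linMulLin_mem_NS {k : V} (hk : g.form k k = 0) (h0 : k ≠ 0) :
    BilinForm.linMulLin (g.form k) (g.form k) ∈ g.NS := by
  let _ : Unique (Fin (0 + 1)) := inferInstanceAs (Unique (Fin 1))
  let w : Fin (0 + 1) → V := fun _ => k
  have hw : LinearIndependent ℝ w := LinearIndependent.of_subsingleton 0 h0
  have hdet : (gramMatrix g.form w).det = 0 := by
    rw [Matrix.det_unique, gramMatrix_apply, hk]
  refine ⟨0, g.wedgeFlat w, (g.isNullForm_wedgeFlat_iff hw).2 ?_, LinearMap.ext₂ fun x y => ?_⟩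
  · rw [factorEigenvalue, hdet, zero_div, mul_zero]
  · rw [superenergy_wedgeFlat_apply, hdet, Matrix.adjugate_subsingleton, Matrix.one_mulVec]
    simp [dotProduct, w]

end SimpleForms

end LorentzMetric

theorem exists_linearIndependent_span_eq {K V : Type*} [DivisionRing K] [AddCommGroup V]
    [Module K V] [FiniteDimensional K V] {W : Submodule K V} (hW : W ≠ ⊥) :
    ∃ (q : ℕ) (w : Fin (q + 1) → V),
      LinearIndependent K w ∧ Submodule.span K (Set.range w) = W := by
  obtain ⟨q, hq⟩ := Nat.exists_eq_add_one_of_ne_zero (Submodule.finrank_eq_zero.not.2 hW)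
  let b : Basis (Fin (q + 1)) K W := Module.finBasisOfFinrankEq K W hq
  refine ⟨q, W.subtype ∘ b, b.linearIndependent.map' W.subtype W.ker_subtype, ?_⟩
  rw [Set.range_comp, Submodule.span_image, b.span_eq, Submodule.map_subtype_top]

namespace LorentzMetric

section CrossSquare

variable {V : Type*} [AddCommGroup V] [Module ℝ V] [FiniteDimensional ℝ V]
  {g : LorentzMetric V} {t : V} {T : BilinForm ℝ V} {c f : ℝ}

theorem form_toMap (x y : V) : g.form (g.toMap T x) y = T x y :=
  g.form_sharp (T x) y

theorem form_toMap_right (hT : T.IsSymm) (x y : V) : g.form x (g.toMap T y) = T x y := by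
  rw [g.form_comm, form_toMap, hT.eq]

theorem toMap_neg : g.toMap (-T) = -g.toMap T :=
  LinearMap.comp_neg ..

theorem cross_self_apply (x y : V) :
    g.cross T T x y = g.form (g.toMap T x) (g.toMap T y) :=
  (g.form_sharp (T x) _).symm

theorem isSymm_cross_self : (g.cross T T).IsSymm :=
  BilinForm.isSymm_iff.2 ⟨fun x y => by
    rw [RingHom.id_apply, cross_self_apply, cross_self_apply, g.form_comm]⟩

theorem cross_neg : g.cross (-T) (-T) = g.cross T T := by
  refine LinearMap.ext₂ fun x y => ?_
  simp only [cross_self_apply, toMap_neg, LinearMap.neg_apply, map_neg, neg_neg]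

theorem form_toMap_toMap (hf : g.cross T T = f • g.form) (x y : V) :
    g.form (g.toMap T x) (g.toMap T y) = f * g.form x y := by
  rw [← cross_self_apply, hf]
  rfl

theorem toMap_toMap (hT : T.IsSymm) (hf : g.cross T T = f • g.form) (x : V) :
    g.toMap T (g.toMap T x) = f • x := by
  refine g.ext_form fun z => ?_
  rw [form_toMap, ← form_toMap_right hT, form_toMap_toMap hf, map_smul]
  rfl

theorem apply_self_ne_zero (ht : 0 < g.form t t) (hT : T.IsSymm) (hf : g.cross T T = f • g.form)
    (hf0 : 0 ≤ f) (hT0 : T ≠ 0) : T t t ≠ 0 := by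
  intro h
  have hAt : g.toMap T t = 0 := by
    refine g.eq_zero_of_orthogonal_of_nonneg ht ((form_toMap_right hT t t).trans h) ?_
    rw [form_toMap_toMap hf]
    positivity
  have hf_zero : f = 0 := by
    have hAtt := form_toMap_toMap hf t t
    rw [hAt, map_zero] at hAtt
    exact (mul_eq_zero.1 hAtt.symm).resolve_right ht.ne'
  refine hT0 (LinearMap.ext₂ fun x y => ?_)
  have hAx : g.toMap T x = 0 := by
    refine g.eq_zero_of_orthogonal_of_nonneg ht ?_ ?_
    · rw [form_toMap_right hT, ← form_toMap (g := g), hAt, map_zero, LinearMap.zero_apply]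
    · rw [form_toMap_toMap hf, hf_zero, zero_mul]
  rw [← form_toMap (g := g), hAx, map_zero]
  rfl

theorem nonneg_of_cross_eq (hN : 3 ≤ finrank ℝ V) (ht : 0 < g.form t t) (hT : T.IsSymm)
    (hf : g.cross T T = f • g.form) : 0 ≤ f := by
  have hker := LinearMap.ker_ne_bot_of_finrank_lt (f := (g.form t).prod (g.form (g.toMap T t)))
    (by rw [Module.finrank_prod, Module.finrank_self]; omega)
  obtain ⟨x, hx, h0⟩ := (Submodule.ne_bot_iff _).1 hker
  obtain ⟨htx, hAtx⟩ : g.form t x = 0 ∧ g.form (g.toMap T t) x = 0 := Prod.ext_iff.1 hx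
  have hAx : g.form (g.toMap T x) (g.toMap T x) ≤ 0 := by
    refine g.form_self_nonpos ht ?_
    rwa [form_toMap_right hT, ← form_toMap (g := g)]
  rw [form_toMap_toMap hf] at hAx
  exact nonneg_of_mul_nonpos_left hAx (g.form_self_neg ht htx h0)

theorem mul_apply_eq_of_cross_eq_zero (ht : 0 < g.form t t) (hT : T.IsSymm)
    (h : g.cross T T = 0) (x y : V) : T t t * T x y = T t x * T t y := by
  have hnull : ∀ u v, g.form (g.toMap T u) (g.toMap T v) = 0 := fun u v => by
    rw [← cross_self_apply, h]
    rfl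
  have hzero : T t t • g.toMap T x - T t x • g.toMap T t = 0 := by
    refine g.eq_zero_of_orthogonal_of_nonneg ht ?_ ?_
    · simp only [map_sub, map_smul, form_toMap_right hT, smul_eq_mul]
      ring
    · simp [hnull]
  have hy := congrArg (fun v => g.form v y) hzero
  simpa [form_toMap, sub_eq_zero] using hy

theorem mem_NS_of_cross_eq_zero (ht : 0 < g.form t t) (hT : T.IsSymm) (hpos : 0 < T t t)
    (h : g.cross T T = 0) : T ∈ g.NS := by
  have hnull : g.form (g.toMap T t) (g.toMap T t) = 0 := by
    rw [← cross_self_apply, h]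
    rfl
  have hAt : g.toMap T t ≠ 0 := by
    intro hAt
    rw [← form_toMap (g := g), hAt, map_zero] at hpos
    exact lt_irrefl 0 hpos
  have hsquare : T = (T t t)⁻¹ •
      BilinForm.linMulLin (g.form (g.toMap T t)) (g.form (g.toMap T t)) := by
    refine LinearMap.ext₂ fun x y => ?_
    rw [LinearMap.smul_apply, LinearMap.smul_apply, BilinForm.linMulLin_apply, form_toMap,
      form_toMap, ← mul_apply_eq_of_cross_eq_zero ht hT h, smul_eq_mul,
      inv_mul_cancel_left₀ hpos.ne']
  rw [hsquare]
  exact smul_mem_NS (inv_pos.2 hpos) (linMulLin_mem_NS hnull hAt)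

theorem mul_superenergy_eq_of_span_eq_eigenspace (hT : T.IsSymm)
    (hf : g.cross T T = c ^ 2 • g.form) {q : ℕ} {w : Fin (q + 1) → V}
    (hspan : Submodule.span ℝ (Set.range w) = Module.End.eigenspace (g.toMap T) c) :
    c • g.superenergy (g.wedgeFlat w) = g.factorEigenvalue w • T := by
  refine LinearMap.ext₂ fun x y => ?_
  have hmem : c • y + g.toMap T y ∈ Submodule.span ℝ (Set.range w) := by
    rw [hspan, Module.End.mem_eigenspace_iff, map_add, map_smul, toMap_toMap hT hf]
    module
  have horth : ∀ i, g.form (w i) (c • y - g.toMap T y) = 0 := by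
    intro i
    have hwi : g.toMap T (w i) = c • w i := by
      rw [← Module.End.mem_eigenspace_iff, ← hspan]
      exact Submodule.subset_span (Set.mem_range_self i)
    rw [map_sub, map_smul, form_toMap_right hT, ← form_toMap (g := g) (T := T), hwi, map_smul,
      LinearMap.smul_apply, sub_self]
  have hplus := g.superenergy_wedgeFlat_of_mem_span x hmem
  have hminus := g.superenergy_wedgeFlat_of_orthogonal x horth
  simp only [map_add, map_sub, map_smul, smul_eq_mul, form_toMap_right hT] at hplus hminus
  simp only [LinearMap.smul_apply, smul_eq_mul]
  linarith

theorem mem_SS_of_cross_eq_sq_smul (ht : 0 < g.form t t) (hT : T.IsSymm) (hpos : 0 < T t t)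
    (hc : 0 < c) (hf : g.cross T T = c ^ 2 • g.form) : T ∈ g.SS := by
  have hmem : c • t + g.toMap T t ∈ Module.End.eigenspace (g.toMap T) c := by
    rw [Module.End.mem_eigenspace_iff, map_add, map_smul, toMap_toMap hT hf]
    module
  have hne : c • t + g.toMap T t ≠ 0 := by
    intro h
    have htimelike := congrArg (g.form t) h
    rw [map_add, map_smul, form_toMap_right hT, map_zero, smul_eq_mul] at htimelike
    have : 0 < c * g.form t t := mul_pos hc ht
    linarith
  obtain ⟨q, w, hw, hspan⟩ :=
    exists_linearIndependent_span_eq ((Submodule.ne_bot_iff _).2 ⟨_, hmem, hne⟩)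
  have hprop := mul_superenergy_eq_of_span_eq_eigenspace hT hf hspan
  have hμ : 0 < g.factorEigenvalue w := by
    have htt : c * g.superenergy (g.wedgeFlat w) t t = g.factorEigenvalue w * T t t :=
      congrArg (fun B : BilinForm ℝ V => B t t) hprop
    refine pos_of_mul_pos_left (htt ▸ ?_) hpos.le
    exact mul_pos hc (g.superenergy_wedgeFlat_self_pos ht hw)
  have hTw : T = (c / g.factorEigenvalue w) • g.superenergy (g.wedgeFlat w) := by
    rw [div_eq_inv_mul, mul_smul, hprop, inv_smul_smul₀ hμ.ne']
  rw [hTw]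
  exact smul_mem_SS (div_pos hc hμ)
    ⟨q, _, g.isSimpleForm_iff_exists_wedgeFlat.2 ⟨w, hw, rfl⟩, rfl⟩

theorem cross_superenergy_wedgeFlat {q : ℕ} (w : Fin (q + 1) → V) :
    g.cross (g.superenergy (g.wedgeFlat w)) (g.superenergy (g.wedgeFlat w)) =
      g.factorEigenvalue w ^ 2 • g.form := by
  set S := g.superenergy (g.wedgeFlat w) with hS
  set μ := g.factorEigenvalue w with hμ
  have hsymm : S.IsSymm := g.isSymm_superenergy_wedgeFlat w
  refine LinearMap.ext₂ fun x y => ?_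
  have horth : ∀ i, g.form (w i) (g.toMap S y - μ • y) = 0 := by
    intro i
    rw [map_sub, map_smul, form_toMap_right hsymm, hsymm.eq, hS,
      superenergy_wedgeFlat_factor, g.form_comm y, smul_eq_mul, sub_self]
  have hminus := g.superenergy_wedgeFlat_of_orthogonal x horth
  simp only [map_sub, map_smul, smul_eq_mul, form_toMap_right hsymm, ← hS, ← hμ] at hminus
  rw [cross_self_apply, form_toMap, LinearMap.smul_apply, LinearMap.smul_apply, smul_eq_mul]
  linear_combination hminus

end CrossSquare

section NullConeMaps

variable {V : Type*} [AddCommGroup V] [Module ℝ V] {g : LorentzMetric V} {t : V}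
  {A L : V →ₗ[ℝ] V} {c : ℝ}

theorem isTimeReversal_iff_isOrthochronous_neg :
    g.IsTimeReversal t A ↔ g.IsOrthochronous t (-A) := by
  simp [IsTimeReversal, IsOrthochronous, IsNullConePreserving]

theorem isOrthochronous_smul_iff (hc : 0 < c) :
    g.IsOrthochronous t (c • A) ↔ g.IsOrthochronous t A := by
  simp [IsOrthochronous, IsNullConePreserving, hc, hc.ne']

theorem isLorentzTransformation_neg_iff :
    g.IsLorentzTransformation (-L) ↔ g.IsLorentzTransformation L := by
  simp [IsLorentzTransformation]

end NullConeMaps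

section Characterization

variable {V : Type*} [AddCommGroup V] [Module ℝ V] [FiniteDimensional ℝ V]
  {g : LorentzMetric V} {t : V} {T : BilinForm ℝ V} {A L : V →ₗ[ℝ] V} {c f : ℝ}

theorem mem_SS_iff (ht : 0 < g.form t t) :
    T ∈ g.SS ↔ T.IsSymm ∧ 0 < T t t ∧ ∃ f : ℝ, 0 ≤ f ∧ g.cross T T = f • g.form := by
  constructor
  · rintro ⟨q, Ω, hΩ, rfl⟩
    obtain ⟨w, hw, rfl⟩ := g.isSimpleForm_iff_exists_wedgeFlat.1 hΩ
    exact ⟨g.isSymm_superenergy_wedgeFlat w, g.superenergy_wedgeFlat_self_pos ht hw, _,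
      sq_nonneg _, cross_superenergy_wedgeFlat w⟩
  · rintro ⟨hT, hpos, f, hf0, hf⟩
    rcases hf0.eq_or_lt with rfl | hf0
    · obtain ⟨q, Ω, hΩ, h⟩ := mem_NS_of_cross_eq_zero ht hT hpos (hf.trans (zero_smul ℝ g.form))
      exact ⟨q, Ω, hΩ.1, h⟩
    · exact mem_SS_of_cross_eq_sq_smul ht hT hpos (Real.sqrt_pos.2 hf0)
        (by rw [Real.sq_sqrt hf0.le, hf])

theorem mem_NS_iff_cross_eq_zero (ht : 0 < g.form t t) :
    T ∈ g.NS ↔ T.IsSymm ∧ 0 < T t t ∧ g.cross T T = 0 := by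
  constructor
  · rintro ⟨q, Ω, hΩ, rfl⟩
    obtain ⟨w, hw, rfl⟩ := g.isSimpleForm_iff_exists_wedgeFlat.1 hΩ.1
    refine ⟨g.isSymm_superenergy_wedgeFlat w, g.superenergy_wedgeFlat_self_pos ht hw, ?_⟩
    rw [cross_superenergy_wedgeFlat, (g.isNullForm_wedgeFlat_iff hw).1 hΩ, zero_pow two_ne_zero,
      zero_smul]
  · rintro ⟨hT, hpos, h⟩
    exact mem_NS_of_cross_eq_zero ht hT hpos h

theorem mem_SS_sdiff_NS_iff_cross_eq_sq_smul (ht : 0 < g.form t t) :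
    T ∈ g.SS \ g.NS ↔
      T.IsSymm ∧ 0 < T t t ∧ ∃ c : ℝ, 0 < c ∧ g.cross T T = c ^ 2 • g.form := by
  rw [Set.mem_sdiff, mem_SS_iff ht, mem_NS_iff_cross_eq_zero ht]
  constructor
  · rintro ⟨⟨hT, hpos, f, hf0, hf⟩, hNS⟩
    have hne : f ≠ 0 := by
      rintro rfl
      exact hNS ⟨hT, hpos, hf.trans (zero_smul ℝ g.form)⟩
    exact ⟨hT, hpos, √f, Real.sqrt_pos.2 (hf0.lt_of_ne' hne), by rw [Real.sq_sqrt hf0, hf]⟩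
  · rintro ⟨hT, hpos, c, hc, hf⟩
    refine ⟨⟨hT, hpos, c ^ 2, sq_nonneg c, hf⟩, fun h => ?_⟩
    exact smul_ne_zero (pow_ne_zero 2 hc.ne') (g.form_ne_zero ht) (hf.symm.trans h.2.2)

theorem exists_cross_eq_iff (hN : 2 ≤ finrank ℝ V) (ht : 0 < g.form t t) (hT : T.IsSymm) :
    (∃ f : ℝ, (finrank ℝ V = 2 → 0 ≤ f) ∧ g.cross T T = f • g.form) ↔
      (T = 0 ∨ T ∈ g.SS ∨ -T ∈ g.SS) := by
  rw [mem_SS_iff ht, mem_SS_iff ht, BilinForm.isSymm_neg, cross_neg]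
  constructor
  · rintro ⟨f, h2, hf⟩
    have hf0 : 0 ≤ f := by
      rcases hN.eq_or_lt with h | h
      · exact h2 h.symm
      · exact nonneg_of_cross_eq h ht hT hf
    refine or_iff_not_imp_left.2 fun h0 => ?_
    rcases (apply_self_ne_zero ht hT hf hf0 h0).lt_or_gt with h | h
    · exact Or.inr ⟨hT, neg_pos.2 h, f, hf0, hf⟩
    · exact Or.inl ⟨hT, h, f, hf0, hf⟩
  · rintro (rfl | ⟨-, -, f, hf0, hf⟩ | ⟨-, -, f, hf0, hf⟩)
    · exact ⟨0, fun _ => le_rfl, (zero_smul ℝ g.form).symm⟩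
    · exact ⟨f, fun _ => hf0, hf⟩
    · exact ⟨f, fun _ => hf0, hf⟩

theorem isNullConeBiPreserving_neg_iff :
    g.IsNullConeBiPreserving (-A) ↔ g.IsNullConeBiPreserving A := by
  simp [IsNullConeBiPreserving, IsNullConePreserving, LinearMap.comp_neg]

theorem isNullConeBiPreserving_toMap (hT : T.IsSymm) (hf : g.cross T T = f • g.form) :
    g.IsNullConeBiPreserving (g.toMap T) := by
  have hpreserving : g.IsNullConePreserving (g.toMap T) := fun k hk => by
    rw [form_toMap_toMap hf, hk, mul_zero]
  have hsharp : ∀ κ : Dual ℝ V, g.sharp (κ ∘ₗ g.toMap T) = g.toMap T (g.sharp κ) := fun κ =>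
    g.ext_form fun z => by
      rw [form_sharp, form_toMap, ← form_toMap_right hT, form_sharp, LinearMap.comp_apply]
  exact ⟨hpreserving, fun κ hκ => hsharp κ ▸ hpreserving _ hκ⟩

theorem isOrthochronous_toMap (ht : 0 < g.form t t) (hT : T.IsSymm) (hf0 : 0 ≤ f)
    (hf : g.cross T T = f • g.form) (hpos : 0 < T t t) : g.IsOrthochronous t (g.toMap T) := by
  refine ⟨(isNullConeBiPreserving_toMap hT hf).1, fun k hk htk => ?_⟩
  have hnonneg : 0 ≤ g.form (g.toMap T t) k := by
    refine g.form_nonneg_of_future_causal ht ?_ hk.ge ?_ htk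
    · rw [form_toMap_toMap hf]
      positivity
    · rwa [form_toMap_right hT]
  rw [form_toMap, ← form_toMap_right (g := g) hT] at hnonneg
  refine hnonneg.eq_or_lt.imp_left fun hzero => ?_
  exact g.eq_zero_of_orthogonal_of_nonneg ht hzero.symm (by rw [form_toMap_toMap hf, hk, mul_zero])

theorem IsOrthochronous.form_apply_self_nonneg (hN : 2 ≤ finrank ℝ V) (ht : 0 < g.form t t)
    (hA : g.IsOrthochronous t A) : 0 ≤ g.form t (A t) := by
  have hnull : ∀ k, g.form k k = 0 → 0 < g.form t k → 0 ≤ g.form t (A k) := by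
    intro k hk htk
    rcases hA.2 k hk htk with h | h
    · rw [h, map_zero]
    · exact h.le
  obtain ⟨k, l, hk, hl, htk, htl, hkl⟩ := g.exists_future_null_add_eq hN ht
  have hsum : g.form t (A t) = g.form t (A k) + g.form t (A l) := by
    rw [← map_add, ← map_add, hkl]
  rw [hsum]
  exact add_nonneg (hnull k hk htk) (hnull l hl htl)

theorem isOrthochronous_toMap_iff (hN : 2 ≤ finrank ℝ V) (ht : 0 < g.form t t) (hT : T.IsSymm)
    (hf0 : 0 ≤ f) (hf : g.cross T T = f • g.form) (hT0 : T ≠ 0) :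
    g.IsOrthochronous t (g.toMap T) ↔ 0 < T t t := by
  refine ⟨fun h => ?_, isOrthochronous_toMap ht hT hf0 hf⟩
  have hnonneg := h.form_apply_self_nonneg hN ht
  rw [form_toMap_right hT] at hnonneg
  exact hnonneg.lt_of_ne' (apply_self_ne_zero ht hT hf hf0 hT0)

theorem cross_eq_sq_smul_iff (hc : c ≠ 0) (hL : g.toMap T = c • L) :
    T.IsSymm ∧ g.cross T T = c ^ 2 • g.form ↔ g.IsLorentzTransformation L ∧ IsInvolutory L := by
  have hTL : ∀ x y, T x y = c * g.form (L x) y := fun x y => by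
    rw [← form_toMap (g := g), hL, LinearMap.smul_apply, map_smul]
    rfl
  have hcross : ∀ x y, g.cross T T x y = c ^ 2 * g.form (L x) (L y) := fun x y => by
    rw [cross_self_apply, hL]
    simp only [LinearMap.smul_apply, map_smul, smul_eq_mul]
    ring
  constructor
  · rintro ⟨hT, hf⟩
    refine ⟨fun x y => mul_left_cancel₀ (pow_ne_zero 2 hc) ?_,
      LinearMap.ext fun x => smul_right_injective V (pow_ne_zero 2 hc) ?_⟩
    · rw [← hcross, hf]
      rfl
    · have hsq := toMap_toMap hT hf x
      rwa [hL, LinearMap.smul_apply, LinearMap.smul_apply, map_smul, smul_smul, ← pow_two] at hsq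
  · rintro ⟨hlorentz, hinv⟩
    refine ⟨BilinForm.isSymm_iff.2 ⟨fun x y => ?_⟩, LinearMap.ext₂ fun x y => ?_⟩
    · have hLLy : L (L y) = y := LinearMap.congr_fun hinv y
      rw [RingHom.id_apply, hTL, hTL, ← hlorentz (L y) x, hLLy, g.form_comm y]
    · rw [hcross, hlorentz]
      rfl

theorem mem_SS_sdiff_NS_iff (hN : 2 ≤ finrank ℝ V) (ht : 0 < g.form t t) :
    T ∈ g.SS \ g.NS ↔ ∃ (c : ℝ) (L : V →ₗ[ℝ] V), 0 < c ∧ g.IsLorentzTransformation L ∧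
      IsInvolutory L ∧ g.IsOrthochronous t L ∧ g.toMap T = c • L := by
  rw [mem_SS_sdiff_NS_iff_cross_eq_sq_smul ht]
  constructor
  · rintro ⟨hT, hpos, c, hc, hf⟩
    have hL : g.toMap T = c • c⁻¹ • g.toMap T := (smul_inv_smul₀ hc.ne' _).symm
    obtain ⟨hlorentz, hinv⟩ := (cross_eq_sq_smul_iff hc.ne' hL).1 ⟨hT, hf⟩
    exact ⟨c, _, hc, hlorentz, hinv, (isOrthochronous_smul_iff (inv_pos.2 hc)).2
      (isOrthochronous_toMap ht hT (sq_nonneg c) hf hpos), hL⟩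
  · rintro ⟨c, L, hc, hlorentz, hinv, hortho, hL⟩
    obtain ⟨hT, hf⟩ := (cross_eq_sq_smul_iff hc.ne' hL).2 ⟨hlorentz, hinv⟩
    have hT0 : T ≠ 0 := by
      rintro rfl
      exact smul_ne_zero (pow_ne_zero 2 hc.ne') (g.form_ne_zero ht) hf.symm
    refine ⟨hT, (isOrthochronous_toMap_iff hN ht hT (sq_nonneg c) hf hT0).1 ?_, c, hc, hf⟩
    rwa [hL, isOrthochronous_smul_iff hc]

theorem neg_mem_SS_sdiff_NS_iff (hN : 2 ≤ finrank ℝ V) (ht : 0 < g.form t t) :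
    -T ∈ g.SS \ g.NS ↔ ∃ (c : ℝ) (L : V →ₗ[ℝ] V), 0 < c ∧ g.IsLorentzTransformation L ∧
      IsInvolutory L ∧ g.IsTimeReversal t L ∧ g.toMap T = c • L := by
  rw [mem_SS_sdiff_NS_iff hN ht]
  refine exists_congr fun c => (Equiv.neg (V →ₗ[ℝ] V)).exists_congr fun L => ?_
  rw [Equiv.neg_apply, isLorentzTransformation_neg_iff, isTimeReversal_iff_isOrthochronous_neg,
    neg_neg, IsInvolutory, IsInvolutory, LinearMap.neg_comp, LinearMap.comp_neg, neg_neg, toMap_neg,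
    smul_neg, neg_eq_iff_eq_neg]

theorem det_toMap_eq_zero_iff (hN : finrank ℝ V ≠ 0) (hT : T.IsSymm)
    (hf : g.cross T T = f • g.form) : LinearMap.det (g.toMap T) = 0 ↔ f = 0 := by
  have hsq : g.toMap T ∘ₗ g.toMap T = f • LinearMap.id := LinearMap.ext (toMap_toMap hT hf)
  have hdet : LinearMap.det (g.toMap T) ^ 2 = f ^ finrank ℝ V := by
    rw [pow_two, ← LinearMap.det_comp, hsq, LinearMap.det_smul, LinearMap.det_id, mul_one]
  rw [← pow_eq_zero_iff two_ne_zero, hdet, pow_eq_zero_iff hN]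

theorem mem_NS_of_isOrthochronous (hN : 2 ≤ finrank ℝ V) (ht : 0 < g.form t t) (h0 : T ≠ 0)
    (hT : T.IsSymm) (hdet : LinearMap.det (g.toMap T) = 0)
    (hortho : g.IsOrthochronous t (g.toMap T)) : T ∈ g.NS := by
  obtain ⟨f, hf⟩ := g.eq_smul_form_of_null ht isSymm_cross_self fun k hk => by
    rw [cross_self_apply, hortho.1 k hk]
  obtain rfl : f = 0 := (det_toMap_eq_zero_iff (by omega) hT hf).1 hdet
  exact mem_NS_of_cross_eq_zero ht hT ((isOrthochronous_toMap_iff hN ht hT le_rfl hf h0).1 hortho)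
    (hf.trans (zero_smul ℝ g.form))

theorem mem_NS_iff (hN : 2 ≤ finrank ℝ V) (ht : 0 < g.form t t) :
    T ∈ g.NS ↔ T ≠ 0 ∧ T.IsSymm ∧ LinearMap.det (g.toMap T) = 0 ∧
      g.IsNullConeBiPreserving (g.toMap T) ∧ g.IsOrthochronous t (g.toMap T) := by
  refine ⟨fun h => ?_, fun ⟨h0, hT, hdet, _, hortho⟩ =>
    mem_NS_of_isOrthochronous hN ht h0 hT hdet hortho⟩
  obtain ⟨hT, hpos, hzero⟩ := (mem_NS_iff_cross_eq_zero ht).1 h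
  have hf : g.cross T T = (0 : ℝ) • g.form := hzero.trans (zero_smul ℝ g.form).symm
  have h0 : T ≠ 0 := by
    rintro rfl
    exact lt_irrefl 0 hpos
  exact ⟨h0, hT, (det_toMap_eq_zero_iff (by omega) hT hf).2 rfl,
    isNullConeBiPreserving_toMap hT hf, isOrthochronous_toMap ht hT le_rfl hf hpos⟩

theorem neg_mem_NS_iff (hN : 2 ≤ finrank ℝ V) (ht : 0 < g.form t t) :
    -T ∈ g.NS ↔ T ≠ 0 ∧ T.IsSymm ∧ LinearMap.det (g.toMap T) = 0 ∧
      g.IsNullConeBiPreserving (g.toMap T) ∧ g.IsTimeReversal t (g.toMap T) := by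
  have hdet : LinearMap.det (-g.toMap T) = 0 ↔ LinearMap.det (g.toMap T) = 0 := by
    rw [← neg_one_smul ℝ, LinearMap.det_smul]
    simp
  have hne : -T ≠ 0 ↔ T ≠ 0 := not_congr (neg_eq_zero (a := (T : V →ₗ[ℝ] V →ₗ[ℝ] ℝ)))
  rw [mem_NS_iff hN ht, hne, BilinForm.isSymm_neg, toMap_neg, hdet,
    isNullConeBiPreserving_neg_iff, isTimeReversal_iff_isOrthochronous_neg]

end Characterization

end LorentzMetric

theorem mainTheorem2 {V : Type*} [AddCommGroup V] [Module ℝ V] [FiniteDimensional ℝ V]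
    (hN : 2 ≤ finrank ℝ V) (g : LorentzMetric V) (t : V) (ht : 0 < g.form t t) :
    (∀ T : BilinForm ℝ V, T.IsSymm →
      ((∃ f : ℝ, (finrank ℝ V = 2 → 0 ≤ f) ∧ g.cross T T = f • g.form) ↔
        (T = 0 ∨ T ∈ g.SS ∨ -T ∈ g.SS))) ∧
    (∀ T : BilinForm ℝ V, T ∈ g.SS \ g.NS ↔
      ∃ (c : ℝ) (L : V →ₗ[ℝ] V), 0 < c ∧ g.IsLorentzTransformation L ∧ IsInvolutory L ∧
        g.IsOrthochronous t L ∧ g.toMap T = c • L) ∧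
    (∀ T : BilinForm ℝ V, -T ∈ g.SS \ g.NS ↔
      ∃ (c : ℝ) (L : V →ₗ[ℝ] V), 0 < c ∧ g.IsLorentzTransformation L ∧ IsInvolutory L ∧
        g.IsTimeReversal t L ∧ g.toMap T = c • L) ∧
    (∀ T : BilinForm ℝ V, T ∈ g.NS ↔
      T ≠ 0 ∧ T.IsSymm ∧ LinearMap.det (g.toMap T) = 0 ∧
        g.IsNullConeBiPreserving (g.toMap T) ∧ g.IsOrthochronous t (g.toMap T)) ∧
    (∀ T : BilinForm ℝ V, -T ∈ g.NS ↔
      T ≠ 0 ∧ T.IsSymm ∧ LinearMap.det (g.toMap T) = 0 ∧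
        g.IsNullConeBiPreserving (g.toMap T) ∧ g.IsTimeReversal t (g.toMap T)) :=
  ⟨fun _ hT => LorentzMetric.exists_cross_eq_iff hN ht hT,
    fun _ => LorentzMetric.mem_SS_sdiff_NS_iff hN ht,
    fun _ => LorentzMetric.neg_mem_SS_sdiff_NS_iff hN ht,
    fun _ => LorentzMetric.mem_NS_iff hN ht,
    fun _ => LorentzMetric.neg_mem_NS_iff hN ht⟩
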